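/- Let $p$ be a prime and $n\ge 1$ an integer with $2p-2\ge n^2$ and $(p-1)\nmid n$. Let $H_n$ be the Honda formal group law of height $n$ over $\mathbb{F}_{p^n}$, i.e. the reduction of the formal group law over $\mathbb{Z}$ with logarithm $\sum_{k\ge 0} X^{p^{nk}}/p^k$. Let $\mathbb{S}_n=\mathrm{Aut}(H_n)$, and let $\mathbb{G}_n=\mathbb{S}_n\rtimes \mathrm{Gal}(\mathbb{F}_{p^n}/\mathbb{F}_p)$ be the Morava stabilizer group with its profinite topology, acting on $\mathbb{F}_{p^n}^\times$ through the Galois group. Let $E_0=(E_n)_0$ be the Lubin--Tate ring of $H_n$ (the base of a universal deformation $F$ of $H_n$, with residue field $\mathbb{F}_{p^n}$) and $E_*=E_0[u^{\pm1}]$, with the action $g\mapsto g_*$ of $\mathbb{G}_n$: if $g=(s,\sigma)$, then $g_*|_{E_0}=\varphi$ and $g_*u=h'(0)\,u$, where $(\varphi,h)$ is the unique pair of a local ring homomorphism $\varphi\colon E_0\to E_0$ lifting $\sigma$ and an isomorphism of formal group laws $h\colon \varphi_*F\to F$ lifting $s$. Let $t_0\colon\mathbb{G}_n\to E_0^\times$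 be the crossed homomorphism $g\mapsto g_*u/u$, and let $\eta\colon \mathbb{G}_n\xrightarrow{t_0}E_0^\times\to\mathbb{F}_{p^n}^\times$ be its reduction modulo the maximal ideal. Then the first continuous cohomology group satisfies $H^1(\mathbb{G}_n,\mathbb{F}_{p^n}^\times)\cong\mathbb{Z}/(p^n-1)$. Moreover $\eta$ is the continuous crossed homomorphism $(s,\sigma)\mapsto s'(0)$, and its class generates $H^1(\mathbb{G}_n,\mathbb{F}_{p^n}^\times)$. -/

import Mathlib

noncomputable section

namespace MoravaPic

open MvPowerSeries (X)

/-! ### Homomorphisms of one-dimensional formal group laws -/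

section Hom

variable {R S : Type*} [CommRing R] [CommRing S]

lemma hasSubst_pair {τ : Type*} {a b : MvPowerSeries τ R}
    (ha : a.constantCoeff = 0) (hb : b.constantCoeff = 0) :
    MvPowerSeries.HasSubst ![a, b] :=
  MvPowerSeries.hasSubst_of_constantCoeff_zero fun s => by fin_cases s <;> simpa

lemma constCoeff_pair {τ : Type*} {a b : MvPowerSeries τ R} {G : MvPowerSeries (Fin 2) R}
    (ha : a.constantCoeff = 0) (hb : b.constantCoeff = 0) (hG : G.constantCoeff = 0) :
    (G.subst ![a, b]).constantCoeff = 0 :=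
  MvPowerSeries.constantCoeff_subst_eq_zero (hasSubst_pair ha hb)
    (fun s => by fin_cases s <;> simpa) hG

lemma constCoeff_subst {τ : Type*} {f : PowerSeries R} {a : MvPowerSeries τ R}
    (ha : a.constantCoeff = 0) (hf : PowerSeries.constantCoeff f = 0) :
    (f.subst a).constantCoeff = 0 :=
  PowerSeries.constantCoeff_subst_eq_zero ha f hf

/-- `f(g(a)) = (f ∘ g)(a)`. -/
lemma subst_subst {τ : Type*} (f : PowerSeries R) {g : PowerSeries R} {a : MvPowerSeries τ R}
    (hg : PowerSeries.constantCoeff g = 0) (ha : a.constantCoeff = 0) :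
    f.subst (g.subst a) = PowerSeries.subst a (f.subst g : PowerSeries R) :=
  (PowerSeries.subst_comp_subst_apply (.of_constantCoeff_zero' hg)
    (.of_constantCoeff_zero ha) f).symm

lemma X_subst_eq {τ : Type*} {a : MvPowerSeries τ R} (ha : a.constantCoeff = 0) :
    (PowerSeries.X : PowerSeries R).subst a = a :=
  PowerSeries.subst_X (.of_constantCoeff_zero ha)

/-- `f(G(X, Y))` evaluated at `(a, b)` is `f(G(a, b))`. -/
lemma subst_subst_pair {τ : Type*} (f : PowerSeries R) {G : MvPowerSeries (Fin 2) R}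
    {a b : MvPowerSeries τ R} (hG : G.constantCoeff = 0)
    (ha : a.constantCoeff = 0) (hb : b.constantCoeff = 0) :
    MvPowerSeries.subst ![a, b] (f.subst G) = f.subst (G.subst ![a, b]) :=
  MvPowerSeries.subst_comp_subst_apply (PowerSeries.HasSubst.of_constantCoeff_zero hG).const
    (hasSubst_pair ha hb) f

lemma pair_subst_pair {τ υ : Type*} (G : MvPowerSeries (Fin 2) R)
    {c d : MvPowerSeries υ R} {a : υ → MvPowerSeries τ R} (ha : MvPowerSeries.HasSubst a)
    (hc : c.constantCoeff = 0) (hd : d.constantCoeff = 0) :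
    MvPowerSeries.subst a (G.subst ![c, d]) = G.subst ![c.subst a, d.subst a] := by
  rw [MvPowerSeries.subst_comp_subst_apply (hasSubst_pair hc hd) ha]
  congr! 2 with s
  fin_cases s <;> simp

/-- Substituting `(a, b)` in `G(f(X), f(Y))` gives `G(f(a), f(b))`. -/
lemma pair_subst {τ : Type*} (G : MvPowerSeries (Fin 2) R) {f : PowerSeries R}
    {a b : MvPowerSeries τ R} (hf : PowerSeries.constantCoeff f = 0)
    (ha : a.constantCoeff = 0) (hb : b.constantCoeff = 0) :
    MvPowerSeries.subst ![a, b] (G.subst ![f.subst (X 0 : MvPowerSeries (Fin 2) R),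
      f.subst (X 1 : MvPowerSeries (Fin 2) R)]) = G.subst ![f.subst a, f.subst b] := by
  have h0 : (X 0 : MvPowerSeries (Fin 2) R).constantCoeff = 0 := by simp
  have h1 : (X 1 : MvPowerSeries (Fin 2) R).constantCoeff = 0 := by simp
  rw [pair_subst_pair G (hasSubst_pair ha hb) (constCoeff_subst h0 hf) (constCoeff_subst h1 hf),
    subst_subst_pair f h0 ha hb, subst_subst_pair f h1 ha hb,
    MvPowerSeries.subst_X (hasSubst_pair ha hb), MvPowerSeries.subst_X (hasSubst_pair ha hb)]
  simp

/-- The power series `f` (with zero constant term) is a homomorphism of formal group laws `F → G`: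
`f(F(X, Y)) = G(f(X), f(Y))`. -/
structure IsHom (F G : FormalGroup R) (f : PowerSeries R) : Prop where
  constCoeff : PowerSeries.constantCoeff f = 0
  map_add : f.subst F.toPowerSeries =
    G.toPowerSeries.subst ![f.subst (X 0 : MvPowerSeries (Fin 2) R),
      f.subst (X 1 : MvPowerSeries (Fin 2) R)]

lemma IsHom.apply {τ : Type*} {F G : FormalGroup R} {f : PowerSeries R} (h : IsHom F G f)
    {a b : MvPowerSeries τ R} (ha : a.constantCoeff = 0) (hb : b.constantCoeff = 0) :
    f.subst (F.toPowerSeries.subst ![a, b]) =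
      G.toPowerSeries.subst ![f.subst a, f.subst b] := by
  rw [← subst_subst_pair f F.zero_constantCoeff ha hb, h.map_add, pair_subst _ h.constCoeff ha hb]

lemma subst_X0_X1 (G : MvPowerSeries (Fin 2) R) : G.subst ![X 0, X 1] = G := by
  have : (![X 0, X 1] : Fin 2 → MvPowerSeries (Fin 2) R) = X := by
    ext1 s; fin_cases s <;> rfl
  rw [this, MvPowerSeries.subst_self, id]

lemma IsHom.id (F : FormalGroup R) : IsHom F F PowerSeries.X where
  constCoeff := by simp
  map_add := by
    rw [X_subst_eq F.zero_constantCoeff, X_subst_eq (by simp), X_subst_eq (by simp), subst_X0_X1]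

lemma IsHom.comp {F G H : FormalGroup R} {g f : PowerSeries R} (hg : IsHom G H g)
    (hf : IsHom F G f) : IsHom F H (g.subst f) where
  constCoeff := constCoeff_subst (τ := Unit) hf.constCoeff hg.constCoeff
  map_add := by
    have h0 : (X 0 : MvPowerSeries (Fin 2) R).constantCoeff = 0 := by simp
    have h1 : (X 1 : MvPowerSeries (Fin 2) R).constantCoeff = 0 := by simp
    rw [← subst_subst g hf.constCoeff F.zero_constantCoeff, hf.map_add,
      hg.apply (constCoeff_subst h0 hf.constCoeff) (constCoeff_subst h1 hf.constCoeff),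
      subst_subst g hf.constCoeff h0, subst_subst g hf.constCoeff h1]

lemma constCoeff_map {f : PowerSeries R} (φ : R →+* S) (h : PowerSeries.constantCoeff f = 0) :
    PowerSeries.constantCoeff (PowerSeries.map φ f) = 0 := by
  rw [← PowerSeries.coeff_zero_eq_constantCoeff_apply, PowerSeries.coeff_map,
    PowerSeries.coeff_zero_eq_constantCoeff_apply, h, map_zero]

lemma map_subst_pair {τ : Type*} (φ : R →+* S) (G : MvPowerSeries (Fin 2) R)
    {a b : MvPowerSeries τ R} (ha : a.constantCoeff = 0) (hb : b.constantCoeff = 0) :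
    MvPowerSeries.map φ (G.subst ![a, b]) =
      (MvPowerSeries.map φ G).subst ![MvPowerSeries.map φ a, MvPowerSeries.map φ b] := by
  rw [MvPowerSeries.map_subst (hasSubst_pair ha hb)]
  congr! 2 with s
  fin_cases s <;> simp

lemma map_subst_one {τ : Type*} (φ : R →+* S) (f : PowerSeries R)
    {a : MvPowerSeries τ R} (ha : a.constantCoeff = 0) :
    MvPowerSeries.map φ (f.subst a) = (PowerSeries.map φ f).subst (MvPowerSeries.map φ a) :=
  PowerSeries.map_subst (.of_constantCoeff_zero ha) f

lemma IsHom.map {F G : FormalGroup R} {f : PowerSeries R} (h : IsHom F G f) (φ : R →+* S) :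
    IsHom (F.map φ) (G.map φ) (PowerSeries.map φ f) where
  constCoeff := constCoeff_map φ h.constCoeff
  map_add := by
    have h0 : (X 0 : MvPowerSeries (Fin 2) R).constantCoeff = 0 := by simp
    have h1 : (X 1 : MvPowerSeries (Fin 2) R).constantCoeff = 0 := by simp
    rw [FormalGroup.map_toPowerSeries, FormalGroup.map_toPowerSeries,
      ← map_subst_one φ f F.zero_constantCoeff, h.map_add,
      map_subst_pair φ _ (constCoeff_subst h0 h.constCoeff) (constCoeff_subst h1 h.constCoeff),
      map_subst_one φ f h0, map_subst_one φ f h1]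
    simp

lemma isHom_inv {F G : FormalGroup R} {f : PowerSeries R} (h : IsHom F G f)
    (hu : IsUnit (PowerSeries.coeff 1 f)) : IsHom G F (f.substInvOfIsUnit hu) where
  constCoeff := by simp
  map_add := by
    set g := f.substInvOfIsUnit hu with hg
    have hgc : PowerSeries.constantCoeff g = 0 := by simp [hg]
    have hgf : g.subst f = PowerSeries.X := PowerSeries.subst_substInvOfIsUnit_left f h.constCoeff hu
    have hfg : f.subst g = PowerSeries.X := PowerSeries.subst_substInvOfIsUnit_right f h.constCoeff hu
    have h0 : (X 0 : MvPowerSeries (Fin 2) R).constantCoeff = 0 := by simp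
    have h1 : (X 1 : MvPowerSeries (Fin 2) R).constantCoeff = 0 := by simp
    have h0' := constCoeff_subst h0 hgc
    have h1' := constCoeff_subst h1 hgc
    have key := h.apply h0' h1'
    rw [subst_subst f hgc h0, subst_subst f hgc h1, hfg, X_subst_eq h0, X_subst_eq h1,
      subst_X0_X1] at key
    rw [← key, subst_subst g h.constCoeff (constCoeff_pair h0' h1' F.zero_constantCoeff), hgf,
      X_subst_eq (constCoeff_pair h0' h1' F.zero_constantCoeff)]

/-! ### Transport of a formal group law along an invertible power series -/

lemma order_prod_pair {a b : MvPowerSeries (Fin 2) R}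
    (ha : a.constantCoeff = 0) (hb : b.constantCoeff = 0) (d : Fin 2 →₀ ℕ) :
    ((d 0 + d 1 : ℕ) : ℕ∞) ≤ (a ^ d 0 * b ^ d 1).order := by
  refine le_trans ?_ MvPowerSeries.le_order_mul
  push_cast
  exact add_le_add (MvPowerSeries.le_order_pow_of_constantCoeff_eq_zero _ ha)
    (MvPowerSeries.le_order_pow_of_constantCoeff_eq_zero _ hb)

/-- The linear coefficients of `G(a, b)`. -/
lemma coeff_single_pair {G : FormalGroup R} {a b : MvPowerSeries (Fin 2) R}
    (ha : a.constantCoeff = 0) (hb : b.constantCoeff = 0) (j : Fin 2) :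
    (G.toPowerSeries.subst ![a, b]).coeff (Finsupp.single j 1) =
      a.coeff (Finsupp.single j 1) + b.coeff (Finsupp.single j 1) := by
  classical
  rw [MvPowerSeries.coeff_subst (hasSubst_pair ha hb),
    finsum_eq_sum_of_support_subset (s := {Finsupp.single 0 1, Finsupp.single 1 1})]
  · rw [Finset.sum_pair (by simp [Finsupp.single_left_inj]), G.lin_coeff_X, G.lin_coeff_Y]
    simp
  · intro d hd
    simp only [Finset.coe_insert, Finset.coe_singleton, Set.mem_insert_iff, Set.mem_singleton_iff]
    by_contra hne
    apply hd
    beta_reduce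
    rw [Finsupp.prod_fintype _ _ (by simp), Fin.prod_univ_two]
    simp only [Matrix.cons_val_zero, Matrix.cons_val_one]
    rcases Nat.lt_or_ge (d 0 + d 1) 2 with hlt | hge
    · have h00 : d 0 = 0 := by
        by_contra h
        apply hne; left
        ext s; fin_cases s
        · simp; lia
        · simp; lia
      have h11 : d 1 = 0 := by
        by_contra h
        apply hne; right
        ext s; fin_cases s
        · simp; lia
        · simp; lia
      have : d = 0 := by ext s; fin_cases s <;> simpa
      rw [this, MvPowerSeries.coeff_zero_eq_constantCoeff_apply, G.zero_constantCoeff, zero_smul]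
    · rw [MvPowerSeries.coeff_of_lt_order (f := a ^ d 0 * b ^ d 1), smul_zero]
      refine lt_of_lt_of_le ?_ (order_prod_pair ha hb d)
      rw [Finsupp.degree_single]
      exact_mod_cast hge

lemma coeff_single_subst {f : PowerSeries R} {a : MvPowerSeries (Fin 2) R}
    (ha : a.constantCoeff = 0) (j : Fin 2) :
    (f.subst a).coeff (Finsupp.single j 1) =
      PowerSeries.coeff 1 f * a.coeff (Finsupp.single j 1) := by
  rw [PowerSeries.coeff_subst (.of_constantCoeff_zero ha), finsum_eq_single _ 1]
  · simp
  · intro d hd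
    rcases d with _ | _ | d
    · simp [MvPowerSeries.coeff_one]
    · exact absurd rfl hd
    · rw [MvPowerSeries.coeff_of_lt_order, smul_zero]
      refine lt_of_lt_of_le ?_ (MvPowerSeries.le_order_pow_of_constantCoeff_eq_zero _ ha)
      rw [Finsupp.degree_single]
      norm_cast
      lia

section Conj

variable (F : FormalGroup R) (f : PowerSeries R) (hf : PowerSeries.constantCoeff f = 0)
  (hu : IsUnit (PowerSeries.coeff 1 f))

/-- The formal group law `f⁻¹(F(f(X), f(Y)))`. -/
def conj : FormalGroup R where
  toPowerSeries := (f.substInvOfIsUnit hu).subst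
    (F.toPowerSeries.subst ![f.subst (X 0 : MvPowerSeries (Fin 2) R),
      f.subst (X 1 : MvPowerSeries (Fin 2) R)])
  zero_constantCoeff := constCoeff_subst (constCoeff_pair (constCoeff_subst (by simp) hf)
    (constCoeff_subst (by simp) hf) F.zero_constantCoeff) (by simp)
  lin_coeff_X := by
    have h0 : (X 0 : MvPowerSeries (Fin 2) R).constantCoeff = 0 := by simp
    have h1 : (X 1 : MvPowerSeries (Fin 2) R).constantCoeff = 0 := by simp
    have h0' := constCoeff_subst h0 hf
    have h1' := constCoeff_subst h1 hf
    rw [coeff_single_subst (constCoeff_pair h0' h1' F.zero_constantCoeff),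
      coeff_single_pair h0' h1', coeff_single_subst h0, coeff_single_subst h1]
    simp [MvPowerSeries.coeff_index_single_X]
  lin_coeff_Y := by
    have h0 : (X 0 : MvPowerSeries (Fin 2) R).constantCoeff = 0 := by simp
    have h1 : (X 1 : MvPowerSeries (Fin 2) R).constantCoeff = 0 := by simp
    have h0' := constCoeff_subst h0 hf
    have h1' := constCoeff_subst h1 hf
    rw [coeff_single_subst (constCoeff_pair h0' h1' F.zero_constantCoeff),
      coeff_single_pair h0' h1', coeff_single_subst h0, coeff_single_subst h1]
    simp [MvPowerSeries.coeff_index_single_X]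
  assoc := by
    set g := f.substInvOfIsUnit hu with hg
    have hgc : PowerSeries.constantCoeff g = 0 := by simp [hg]
    have hfg : f.subst g = PowerSeries.X := PowerSeries.subst_substInvOfIsUnit_right f hf hu
    have h0 : (X 0 : MvPowerSeries (Fin 2) R).constantCoeff = 0 := by simp
    have h1 : (X 1 : MvPowerSeries (Fin 2) R).constantCoeff = 0 := by simp
    have h0' := constCoeff_subst h0 hf
    have h1' := constCoeff_subst h1 hf
    have ev : ∀ {a b : MvPowerSeries (Fin 3) R}, a.constantCoeff = 0 → b.constantCoeff = 0 →
        MvPowerSeries.subst ![a, b] (g.subst (F.toPowerSeries.subst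
          ![f.subst (X 0 : MvPowerSeries (Fin 2) R), f.subst (X 1 : MvPowerSeries (Fin 2) R)])) =
        g.subst (F.toPowerSeries.subst ![f.subst a, f.subst b]) := by
      intro a b ha hb
      rw [subst_subst_pair g (constCoeff_pair h0' h1' F.zero_constantCoeff) ha hb,
        pair_subst _ hf ha hb]
    have hX : ∀ i : Fin 3, (X i : MvPowerSeries (Fin 3) R).constantCoeff = 0 := by simp
    have hfX := fun i : Fin 3 => constCoeff_subst (hX i) hf
    have hF := fun i j : Fin 3 => constCoeff_pair (hfX i) (hfX j) F.zero_constantCoeff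
    have hgF := fun i j : Fin 3 => constCoeff_subst (hF i j) hgc
    rw [ev (hX 0) (hX 1), ev (hX 1) (hX 2), ev (hgF 0 1) (hX 2), ev (hX 0) (hgF 1 2),
      subst_subst f hgc (hF 0 1), subst_subst f hgc (hF 1 2), hfg, X_subst_eq (hF 0 1),
      X_subst_eq (hF 1 2)]
    congr 1
    exact F.assoc' (.of_constantCoeff_zero (hfX 0)) (.of_constantCoeff_zero (hfX 1))
      (.of_constantCoeff_zero (hfX 2))

lemma isHom_conj : IsHom (conj F f hf hu) F f where
  constCoeff := hf
  map_add := by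
    have h0 : (X 0 : MvPowerSeries (Fin 2) R).constantCoeff = 0 := by simp
    have h1 : (X 1 : MvPowerSeries (Fin 2) R).constantCoeff = 0 := by simp
    have h := constCoeff_pair (constCoeff_subst h0 hf) (constCoeff_subst h1 hf)
      F.zero_constantCoeff
    change f.subst ((f.substInvOfIsUnit hu).subst _) = _
    rw [subst_subst f (by simp) h, PowerSeries.subst_substInvOfIsUnit_right f hf hu, X_subst_eq h]

instance [F.IsComm] : (conj F f hf hu).IsComm where
  comm := by
    have h0 : (X 0 : MvPowerSeries (Fin 2) R).constantCoeff = 0 := by simp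
    have h1 : (X 1 : MvPowerSeries (Fin 2) R).constantCoeff = 0 := by simp
    have h0' := constCoeff_subst h0 hf
    have h1' := constCoeff_subst h1 hf
    change (f.substInvOfIsUnit hu).subst _ =
      MvPowerSeries.subst _ ((f.substInvOfIsUnit hu).subst _)
    rw [subst_subst_pair _ (constCoeff_pair h0' h1' F.zero_constantCoeff) h1 h0,
      pair_subst _ hf h1 h0, F.comm' (.of_constantCoeff_zero h1') (.of_constantCoeff_zero h0')]

end Conj

/-- A formal group law is determined by an isomorphism to a given one. -/
lemma IsHom.ext_source {F F' G : FormalGroup R} {f : PowerSeries R} (h : IsHom F G f)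
    (h' : IsHom F' G f) (hu : IsUnit (PowerSeries.coeff 1 f)) : F = F' := by
  apply FormalGroup.ext
  have e : f.subst F.toPowerSeries = f.subst F'.toPowerSeries := h.map_add.trans h'.map_add.symm
  have e' := congrArg (fun z => (f.substInvOfIsUnit hu).subst z) e
  simpa [subst_subst _ h.constCoeff F.zero_constantCoeff,
    subst_subst _ h.constCoeff F'.zero_constantCoeff,
    PowerSeries.subst_substInvOfIsUnit_left f h.constCoeff hu,
    X_subst_eq F.zero_constantCoeff, X_subst_eq F'.zero_constantCoeff] using e'

end Hom

/-! ### The Honda formal group law -/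

section Honda

variable (p n : ℕ)

/-- The logarithm `∑_k X^(p^(n k)) / p^k` of the Honda formal group law of height `n`. -/
def hondaLog : PowerSeries ℚ :=
  PowerSeries.mk fun m => if m = (p ^ n) ^ Nat.log (p ^ n) m then
    ((p : ℚ) ^ Nat.log (p ^ n) m)⁻¹ else 0

lemma constCoeff_hondaLog : PowerSeries.constantCoeff (hondaLog p n) = 0 := by
  rw [← PowerSeries.coeff_zero_eq_constantCoeff_apply]
  simp [hondaLog]

lemma coeff_one_hondaLog : PowerSeries.coeff 1 (hondaLog p n) = 1 := by
  simp [hondaLog]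

lemma isUnit_coeff_one_hondaLog : IsUnit (PowerSeries.coeff 1 (hondaLog p n)) := by
  simp [coeff_one_hondaLog]

/-- The rational Honda formal group law `ℓ⁻¹(ℓ(X) + ℓ(Y))`. -/
def hondaRat : FormalGroup ℚ :=
  conj FormalGroup.𝔾ₐ (hondaLog p n) (constCoeff_hondaLog p n) (isUnit_coeff_one_hondaLog p n)

variable {p n}

lemma one_lt_pow' [hp : Fact p.Prime] [NeZero n] : 1 < p ^ n :=
  Nat.one_lt_pow (NeZero.ne n) hp.out.one_lt

lemma coeff_hondaLog_pow [hp : Fact p.Prime] [NeZero n] (k : ℕ) :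
    PowerSeries.coeff ((p ^ n) ^ k) (hondaLog p n) = ((p : ℚ) ^ k)⁻¹ := by
  rw [hondaLog, PowerSeries.coeff_mk, Nat.log_pow one_lt_pow', if_pos rfl]

lemma coeff_hondaLog_of_ne {m : ℕ} (h : ∀ k, m ≠ (p ^ n) ^ k) :
    PowerSeries.coeff m (hondaLog p n) = 0 := by
  simp [hondaLog, h]

/-- The functional equation `ℓ(X) = X + p⁻¹ ℓ(X^(p^n))`. -/
lemma hondaLog_eq [hp : Fact p.Prime] [NeZero n] :
    hondaLog p n = PowerSeries.X + (p : ℚ)⁻¹ •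
      ((hondaLog p n).subst (PowerSeries.X ^ (p ^ n) : PowerSeries ℚ) : PowerSeries ℚ) := by
  have hq : p ^ n ≠ 0 := by have := one_lt_pow' (p := p) (n := n); lia
  have hq1 := one_lt_pow' (p := p) (n := n)
  ext m
  rw [map_add, PowerSeries.coeff_smul, PowerSeries.coeff_subst_X_pow hq, PowerSeries.coeff_X]
  by_cases hm : ∃ k, m = (p ^ n) ^ k
  · obtain ⟨k, rfl⟩ := hm
    rw [coeff_hondaLog_pow]
    rcases k with _ | k
    · have : ¬ (p ^ n) ∣ 1 := by rw [Nat.dvd_one]; lia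
      simp [NeZero.ne n, hp.out.ne_one]
    · have h1 : (p ^ n) ^ (k + 1) ≠ 1 := (Nat.one_lt_pow (by lia) hq1).ne'
      rw [if_neg h1, if_pos (dvd_pow_self _ (by lia)), pow_succ (p ^ n) k,
        Nat.mul_div_cancel _ (by lia), coeff_hondaLog_pow]
      have : (p : ℚ) ≠ 0 := by exact_mod_cast hp.out.ne_zero
      rw [smul_eq_mul, pow_succ, mul_inv, zero_add, mul_comm]
      rfl
  · push Not at hm
    rw [coeff_hondaLog_of_ne hm, if_neg (by simpa using hm 0)]
    split_ifs with hd
    · obtain ⟨c, rfl⟩ := hd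
      rw [Nat.mul_div_cancel_left _ (by lia), coeff_hondaLog_of_ne]
      · simp
      · rintro k rfl
        exact hm (k + 1) (by ring)
    · simp

/-- `ℓ(U) = U + p⁻¹ ℓ(U^(p^n))`. -/
lemma hondaLog_subst [hp : Fact p.Prime] [NeZero n] {U : MvPowerSeries (Fin 2) ℚ}
    (hU : U.constantCoeff = 0) :
    (hondaLog p n).subst U = U + (p : ℚ)⁻¹ • (hondaLog p n).subst (U ^ (p ^ n)) := by
  have hq : p ^ n ≠ 0 := by have := one_lt_pow' (p := p) (n := n); lia
  have hs : PowerSeries.HasSubst U := .of_constantCoeff_zero hU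
  conv_lhs => rw [hondaLog_eq]
  rw [PowerSeries.subst_add hs, PowerSeries.subst_smul hs, PowerSeries.subst_X hs,
    ← subst_subst _ (by rw [map_pow, PowerSeries.constantCoeff_X, zero_pow hq]) hU, PowerSeries.subst_pow hs, PowerSeries.subst_X hs]

/-- If `U - V` has order `> deg m`, then `ℓ(U)` and `ℓ(V)` have the same coefficient at `m`. -/
lemma coeff_subst_congr (f : PowerSeries ℚ) {U V : MvPowerSeries (Fin 2) ℚ}
    (hU : U.constantCoeff = 0) (hV : V.constantCoeff = 0) {m : Fin 2 →₀ ℕ}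
    (h : (m.degree : ℕ∞) < (U - V).order) :
    MvPowerSeries.coeff m (f.subst U) = MvPowerSeries.coeff m (f.subst V) := by
  rw [PowerSeries.coeff_subst (.of_constantCoeff_zero hU),
    PowerSeries.coeff_subst (.of_constantCoeff_zero hV)]
  refine finsum_congr fun j => ?_
  congr 1
  rw [← sub_eq_zero, ← map_sub]
  obtain ⟨c, hc⟩ := sub_dvd_pow_sub_pow U V j
  rw [hc]
  refine MvPowerSeries.coeff_of_lt_order (h.trans_le (le_trans ?_ MvPowerSeries.le_order_mul))
  exact le_self_add

lemma order_pow_sub_pow {U V : MvPowerSeries (Fin 2) ℚ}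
    (hU : U.constantCoeff = 0) (hV : V.constantCoeff = 0) (j : ℕ) :
    (U - V).order + j ≤ (U ^ (j + 1) - V ^ (j + 1)).order := by
  induction j with
  | zero => simp
  | succ j ih =>
    have e : U ^ (j + 1 + 1) - V ^ (j + 1 + 1) =
        (U - V) * U ^ (j + 1) + (U ^ (j + 1) - V ^ (j + 1)) * V := by ring
    rw [e]
    refine le_trans (le_min ?_ ?_) MvPowerSeries.min_order_le_add
    · refine le_trans ?_ MvPowerSeries.le_order_mul
      gcongr
      exact MvPowerSeries.le_order_pow_of_constantCoeff_eq_zero _ hU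
    · refine le_trans ?_ MvPowerSeries.le_order_mul
      push_cast
      rw [← add_assoc]
      gcongr
      exact MvPowerSeries.one_le_order_iff_constCoeff_eq_zero.mpr hV

/-- If `U - V` has order `≥ deg m`, then `ℓ(U) - ℓ(V)` and `U - V` agree at `m`. -/
lemma coeff_hondaLog_subst_sub {U V : MvPowerSeries (Fin 2) ℚ}
    (hU : U.constantCoeff = 0) (hV : V.constantCoeff = 0) {m : Fin 2 →₀ ℕ}
    (h : (m.degree : ℕ∞) ≤ (U - V).order) :
    MvPowerSeries.coeff m ((hondaLog p n).subst U) -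
      MvPowerSeries.coeff m ((hondaLog p n).subst V) = MvPowerSeries.coeff m (U - V) := by
  have hsU : PowerSeries.HasSubst U := .of_constantCoeff_zero hU
  have hsV : PowerSeries.HasSubst V := .of_constantCoeff_zero hV
  rw [PowerSeries.coeff_subst hsU, PowerSeries.coeff_subst hsV,
    ← finsum_sub_distrib (PowerSeries.coeff_subst_finite hsU _ _)
      (PowerSeries.coeff_subst_finite hsV _ _), finsum_eq_single _ 1]
  · simp [coeff_one_hondaLog]
  · intro j hj
    rcases j with _ | _ | j
    · simp
    · exact absurd rfl hj
    · rw [← smul_sub, ← map_sub, MvPowerSeries.coeff_of_lt_order, smul_zero]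
      refine lt_of_lt_of_le ?_ (order_pow_sub_pow hU hV (j + 1))
      refine lt_of_lt_of_le ?_ (add_le_add_left h _)
      norm_cast
      lia

/-- Integral congruent arguments have logarithms that are congruent modulo `p`. -/
lemma coeff_hondaLog_subst_sub_int [hp : Fact p.Prime] [NeZero n] {U V : MvPowerSeries (Fin 2) ℤ}
    (hU : U.constantCoeff = 0) (hV : V.constantCoeff = 0)
    (h : (p : MvPowerSeries (Fin 2) ℤ) ∣ U - V) (m : Fin 2 →₀ ℕ) :
    ∃ z : ℤ, MvPowerSeries.coeff m ((hondaLog p n).subst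
        (MvPowerSeries.map (Int.castRingHom ℚ) U)) -
      MvPowerSeries.coeff m ((hondaLog p n).subst (MvPowerSeries.map (Int.castRingHom ℚ) V)) =
        (p : ℚ) * z := by
  have hsU : PowerSeries.HasSubst (MvPowerSeries.map (Int.castRingHom ℚ) U) :=
    .of_constantCoeff_zero (by simp [MvPowerSeries.constantCoeff_map, hU])
  have hsV : PowerSeries.HasSubst (MvPowerSeries.map (Int.castRingHom ℚ) V) :=
    .of_constantCoeff_zero (by simp [MvPowerSeries.constantCoeff_map, hV])
  rw [PowerSeries.coeff_subst hsU, PowerSeries.coeff_subst hsV,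
    ← finsum_sub_distrib (PowerSeries.coeff_subst_finite hsU _ _)
      (PowerSeries.coeff_subst_finite hsV _ _)]
  refine finsum_induction (fun x : ℚ => ∃ z : ℤ, x = (p : ℚ) * z) ⟨0, by simp⟩ ?_ ?_
  · rintro _ _ ⟨a, rfl⟩ ⟨b, rfl⟩
    exact ⟨a + b, by push_cast; ring⟩
  · intro j
    by_cases hj : ∃ k, j = (p ^ n) ^ k
    · obtain ⟨k, rfl⟩ := hj
      obtain ⟨c, hc⟩ := dvd_sub_pow_of_dvd_sub h (n * k)
      refine ⟨(p : ℤ) ^ (n * k - k) * MvPowerSeries.coeff m c, ?_⟩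
      have hle : k ≤ n * k := Nat.le_mul_of_pos_left k (Nat.pos_of_ne_zero (NeZero.ne n))
      have hp0 : (p : ℚ) ≠ 0 := by exact_mod_cast hp.out.ne_zero
      have hsplit : n * k + 1 = k + (n * k - k) + 1 := by lia
      have hcast : ((p : MvPowerSeries (Fin 2) ℤ) ^ (n * k + 1)) =
          MvPowerSeries.C ((p : ℤ) ^ (n * k + 1)) := by simp
      rw [coeff_hondaLog_pow, ← smul_sub, ← map_sub, ← map_pow, ← map_pow, ← map_sub, ← pow_mul,
        hc, hcast, MvPowerSeries.coeff_map, MvPowerSeries.coeff_C_mul, hsplit]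
      simp only [smul_eq_mul, eq_intCast]
      push_cast
      rw [pow_succ, pow_add]
      field_simp
    · push Not at hj
      exact ⟨0, by rw [coeff_hondaLog_of_ne hj]; simp⟩

lemma exists_series (z : (Fin 2 →₀ ℕ) → ℤ) :
    ∃ G : MvPowerSeries (Fin 2) ℤ, ∀ m, MvPowerSeries.coeff m G = z m :=
  ⟨fun m => z m, fun _ => rfl⟩

/-- `G(X^(p^n), Y^(p^n)) ≡ G(X, Y)^(p^n)` modulo `p`. -/
lemma dvd_expand_sub_pow [hp : Fact p.Prime] (G : MvPowerSeries (Fin 2) ℤ) (hq : p ^ n ≠ 0) :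
    (p : MvPowerSeries (Fin 2) ℤ) ∣ G.expand (p ^ n) hq - G ^ (p ^ n) := by
  have h0 : MvPowerSeries.map (Int.castRingHom (ZMod p)) (G.expand (p ^ n) hq - G ^ (p ^ n)) = 0 := by
    rw [map_sub, MvPowerSeries.map_expand, map_pow,
      ← MvPowerSeries.map_iterateFrobenius_expand p hp.out.ne_zero _ n]
    have : iterateFrobenius (ZMod p) p n = RingHom.id (ZMod p) := Subsingleton.elim _ _
    rw [this, MvPowerSeries.map_id, RingHom.id_apply, sub_self]
  have hd : ∀ m, ∃ z : ℤ, MvPowerSeries.coeff m (G.expand (p ^ n) hq - G ^ (p ^ n)) = p * z := by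
    intro m
    have := congrArg (MvPowerSeries.coeff m) h0
    rw [MvPowerSeries.coeff_map, map_zero, eq_intCast, ZMod.intCast_zmod_eq_zero_iff_dvd] at this
    exact this
  choose z hz using hd
  obtain ⟨c, hc⟩ := exists_series z
  refine ⟨c, ?_⟩
  ext m
  rw [hz m]
  have : (p : MvPowerSeries (Fin 2) ℤ) = MvPowerSeries.C (p : ℤ) := by simp
  rw [this, MvPowerSeries.coeff_C_mul, hc]

variable (p n)

lemma hondaRat_log :
    (hondaLog p n).subst (hondaRat p n).toPowerSeries =
      (hondaLog p n).subst (X 0 : MvPowerSeries (Fin 2) ℚ) +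
        (hondaLog p n).subst (X 1 : MvPowerSeries (Fin 2) ℚ) := by
  have h := (isHom_conj FormalGroup.𝔾ₐ (hondaLog p n) (constCoeff_hondaLog p n)
    (isUnit_coeff_one_hondaLog p n)).map_add
  have hs := hasSubst_pair (constCoeff_subst (a := (X 0 : MvPowerSeries (Fin 2) ℚ)) (by simp)
    (constCoeff_hondaLog p n)) (constCoeff_subst (a := (X 1 : MvPowerSeries (Fin 2) ℚ)) (by simp)
    (constCoeff_hondaLog p n))
  rw [FormalGroup.𝔾ₐ_toPowerSeries, MvPowerSeries.subst_add hs, MvPowerSeries.subst_X hs,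
    MvPowerSeries.subst_X hs] at h
  simpa using! h

/-- The coefficients of the rational Honda formal group law are integers. -/
lemma hondaRat_integral [hp : Fact p.Prime] [NeZero n] (m : Fin 2 →₀ ℕ) :
    ∃ z : ℤ, MvPowerSeries.coeff m (hondaRat p n).toPowerSeries = z := by
  have hq1 := one_lt_pow' (p := p) (n := n)
  have hq : p ^ n ≠ 0 := by lia
  induction hd : m.degree using Nat.strong_induction_on generalizing m with
  | _ d ih =>
  rcases Nat.eq_zero_or_pos d with rfl | hdpos
  · rw [Finsupp.degree_eq_zero_iff] at hd
    subst hd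
    exact ⟨0, by simp [(hondaRat p n).zero_constantCoeff]⟩
  set F := (hondaRat p n).toPowerSeries with hF
  set L := hondaLog p n with hL
  have hF0 : F.constantCoeff = 0 := (hondaRat p n).zero_constantCoeff
  -- an integral series agreeing with `F` in degrees `< d`
  have hz : ∀ m' : Fin 2 →₀ ℕ, ∃ z : ℤ, m'.degree < d → MvPowerSeries.coeff m' F = z := by
    intro m'
    by_cases h : m'.degree < d
    · obtain ⟨z, hz⟩ := ih _ h m' rfl
      exact ⟨z, fun _ => hz⟩
    · exact ⟨0, fun h' => absurd h' h⟩
  choose z hz using hz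
  obtain ⟨G, hG⟩ := exists_series z
  have hG0 : G.constantCoeff = 0 := by
    rw [← MvPowerSeries.coeff_zero_eq_constantCoeff_apply, hG]
    have := hz 0 (by simpa using hdpos)
    rw [MvPowerSeries.coeff_zero_eq_constantCoeff_apply, hF0] at this
    exact_mod_cast this.symm
  set B := MvPowerSeries.map (Int.castRingHom ℚ) G with hB
  have hB0 : B.constantCoeff = 0 := by simp [hB, MvPowerSeries.constantCoeff_map, hG0]
  have hFB : (d : ℕ∞) ≤ (F - B).order := by
    refine MvPowerSeries.nat_le_order fun m' hm' => ?_
    rw [map_sub, hz m' hm', hB, MvPowerSeries.coeff_map, hG]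
    simp
  have hEF0 : (F.expand (p ^ n) hq).constantCoeff = 0 := by simp [hF0]
  have hEB0 : (B.expand (p ^ n) hq).constantCoeff = 0 := by simp [hB0]
  have hEFB : (m.degree : ℕ∞) < (F.expand (p ^ n) hq - B.expand (p ^ n) hq).order := by
    rw [← map_sub, MvPowerSeries.order_expand, hd]
    have h2 : (2 : ℕ∞) * d ≤ p ^ n • (F - B).order := by
      rw [nsmul_eq_mul]
      gcongr
      exact_mod_cast hq1
    refine lt_of_lt_of_le ?_ h2
    norm_cast
    lia
  -- the functional equation for `F`
  have hX0 : (X 0 : MvPowerSeries (Fin 2) ℚ).constantCoeff = 0 := by simp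
  have hX1 : (X 1 : MvPowerSeries (Fin 2) ℚ).constantCoeff = 0 := by simp
  have hexp : ∀ {U : MvPowerSeries (Fin 2) ℚ}, U.constantCoeff = 0 →
      (L.subst U).expand (p ^ n) hq = L.subst (U.expand (p ^ n) hq) := fun {U} hU =>
    MvPowerSeries.expand_subst (p ^ n) hq (PowerSeries.HasSubst.of_constantCoeff_zero hU).const
  have hlog : L.subst F = X 0 + X 1 + (p : ℚ)⁻¹ • L.subst (F.expand (p ^ n) hq) := by
    rw [← hexp hF0, hondaRat_log, hondaLog_subst hX0, hondaLog_subst hX1,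
      ← hondaLog_subst hX0, ← hondaLog_subst hX1, map_add, hexp hX0, hexp hX1,
      MvPowerSeries.expand_X, MvPowerSeries.expand_X, hL, hondaLog_subst hX0, hondaLog_subst hX1,
      smul_add]
    ring
  have e1 := coeff_hondaLog_subst_sub (p := p) (n := n) hF0 hB0 (m := m) (by rw [hd]; exact hFB)
  have e2 := coeff_subst_congr L hEF0 hEB0 hEFB
  obtain ⟨w, hw⟩ := coeff_hondaLog_subst_sub_int (p := p) (n := n)
    (U := G.expand (p ^ n) hq) (V := G ^ (p ^ n)) (by simp [hG0])
    (by rw [map_pow, hG0, zero_pow hq]) (dvd_expand_sub_pow G hq) m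
  rw [MvPowerSeries.map_expand, map_pow, ← hB, ← hL, ← e2] at hw
  rw [← hL, hlog, hL, hondaLog_subst hB0, ← hL, map_add, map_add, map_add, map_sub,
    MvPowerSeries.coeff_smul, MvPowerSeries.coeff_smul] at e1
  have hp0 : (p : ℚ) ≠ 0 := by exact_mod_cast hp.out.ne_zero
  have hX : ∀ i : Fin 2, ∃ x : ℤ, MvPowerSeries.coeff m (X i : MvPowerSeries (Fin 2) ℚ) = x := by
    classical
    intro i
    rw [MvPowerSeries.coeff_X]
    split_ifs
    exacts [⟨1, by simp⟩, ⟨0, by simp⟩]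
  obtain ⟨x, hx⟩ := hX 0
  obtain ⟨y, hy⟩ := hX 1
  refine ⟨x + y + w, ?_⟩
  rw [hx, hy] at e1
  rw [sub_eq_iff_eq_add] at hw
  rw [hw] at e1
  push_cast
  have e3 : (p : ℚ)⁻¹ * (p * w) = w := by field_simp
  rw [mul_add, e3] at e1
  linear_combination -e1

lemma exists_hondaInt [Fact p.Prime] [NeZero n] :
    ∃ F : FormalGroup ℤ, F.map (Int.castRingHom ℚ) = hondaRat p n := by
  choose z hz using hondaRat_integral p n
  obtain ⟨G, hG⟩ := exists_series z
  have hmap : MvPowerSeries.map (Int.castRingHom ℚ) G = (hondaRat p n).toPowerSeries := by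
    ext m
    rw [MvPowerSeries.coeff_map, hG, hz]
    simp
  have hinj : Function.Injective (Int.castRingHom ℚ) := Int.cast_injective
  have hinj' : ∀ {σ : Type}, Function.Injective
      (MvPowerSeries.map (σ := σ) (Int.castRingHom ℚ)) := by
    intro σ a b hab
    ext m
    apply hinj
    rw [← MvPowerSeries.coeff_map, ← MvPowerSeries.coeff_map, hab]
  have hG0 : G.constantCoeff = 0 := by
    apply hinj
    rw [← MvPowerSeries.constantCoeff_map, hmap, (hondaRat p n).zero_constantCoeff, map_zero]
  have hX : ∀ i : Fin 3, (X i : MvPowerSeries (Fin 3) ℤ).constantCoeff = 0 := by simp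
  refine ⟨⟨G, hG0, ?_, ?_, ?_⟩, FormalGroup.ext hmap⟩
  · apply hinj
    rw [← MvPowerSeries.coeff_map, hmap, (hondaRat p n).lin_coeff_X, map_one]
  · apply hinj
    rw [← MvPowerSeries.coeff_map, hmap, (hondaRat p n).lin_coeff_Y, map_one]
  · apply hinj'
    rw [map_subst_pair _ _ (constCoeff_pair (hX 0) (hX 1) hG0) (hX 2),
      map_subst_pair _ _ (hX 0) (constCoeff_pair (hX 1) (hX 2) hG0),
      map_subst_pair _ _ (hX 0) (hX 1), map_subst_pair _ _ (hX 1) (hX 2), hmap]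
    simpa using! (hondaRat p n).assoc

/-- The Honda formal group law of height `n` over `ℤ`: its image over `ℚ` is
`ℓ⁻¹(ℓ(X) + ℓ(Y))` with `ℓ(X) = ∑_k X^(p^(n k)) / p^k`. -/
def hondaInt [Fact p.Prime] [NeZero n] : FormalGroup ℤ :=
  (exists_hondaInt p n).choose

lemma hondaInt_map [Fact p.Prime] [NeZero n] :
    (hondaInt p n).map (Int.castRingHom ℚ) = hondaRat p n :=
  (exists_hondaInt p n).choose_spec

/-- The Honda formal group law `H_n` over the field with `p^n` elements: the reduction of
`hondaInt`. -/
def honda [Fact p.Prime] [NeZero n] : FormalGroup (GaloisField p n) :=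
  (hondaInt p n).map (Int.castRingHom _)

end Honda

/-! ### The Morava stabilizer group -/

section Aut

variable {R : Type*} [CommRing R]

/-- The automorphisms of a formal group law `F`: the invertible power series `f` with
`f(F(X, Y)) = F(f(X), f(Y))`. The group law is composition. -/
@[ext]
structure FGLAut (F : FormalGroup R) where
  series : PowerSeries R
  isHom : IsHom F F series
  isUnit : IsUnit (PowerSeries.coeff 1 series)

variable {F : FormalGroup R}

lemma coeff_one_subst {g f : PowerSeries R} (hf : PowerSeries.constantCoeff f = 0) :
    PowerSeries.coeff 1 (g.subst f : PowerSeries R) =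
      PowerSeries.coeff 1 g * PowerSeries.coeff 1 f := by
  rw [PowerSeries.coeff_subst' (.of_constantCoeff_zero' hf), finsum_eq_single _ 1]
  · simp
  · intro d hd
    rcases d with _ | _ | d
    · simp [PowerSeries.coeff_one]
    · exact absurd rfl hd
    · rw [PowerSeries.coeff_of_lt_order (φ := f ^ (d + 1 + 1)), smul_zero]
      refine lt_of_lt_of_le ?_ (PowerSeries.le_order_pow_of_constantCoeff_eq_zero _ hf)
      norm_cast
      lia

instance : Group (FGLAut F) where
  mul f g := ⟨f.series.subst g.series, f.isHom.comp g.isHom, by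
    rw [coeff_one_subst g.isHom.constCoeff]; exact f.isUnit.mul g.isUnit⟩
  one := ⟨PowerSeries.X, IsHom.id F, by simp⟩
  inv f := ⟨f.series.substInvOfIsUnit f.isUnit, isHom_inv f.isHom f.isUnit, by simp⟩
  mul_assoc f g h := FGLAut.ext
    (subst_subst (τ := Unit) f.series g.isHom.constCoeff h.isHom.constCoeff).symm
  one_mul f := FGLAut.ext (X_subst_eq (τ := Unit) f.isHom.constCoeff)
  mul_one f := FGLAut.ext (PowerSeries.X_subst f.series)
  inv_mul_cancel f := FGLAut.ext
    (PowerSeries.subst_substInvOfIsUnit_left f.series f.isHom.constCoeff f.isUnit)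

lemma FGLAut.mul_series (f g : FGLAut F) : (f * g).series = f.series.subst g.series := rfl

lemma FGLAut.one_series : (1 : FGLAut F).series = PowerSeries.X := rfl

/-- The `X`-adic topology: two automorphisms are close if they have the same coefficients up to a
high degree. -/
instance : TopologicalSpace (FGLAut F) :=
  TopologicalSpace.induced (fun f (m : ℕ) => PowerSeries.coeff m f.series)
    (@Pi.topologicalSpace ℕ (fun _ => R) fun _ => ⊥)

/-- The leading coefficient `f'(0)` of an automorphism. -/
def FGLAut.leadingCoeff (f : FGLAut F) : Rˣ := f.isUnit.unit

/-- The action of a ring automorphism fixing the coefficients of `F` on the automorphisms of `F`,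
coefficient by coefficient. -/
def FGLAut.mapEquiv (σ : R ≃+* R) (hσ : F.map (σ : R →+* R) = F) : FGLAut F ≃* FGLAut F where
  toFun f := ⟨PowerSeries.map (σ : R →+* R) f.series, by
    have := f.isHom.map (σ : R →+* R); rwa [hσ] at this, by
    rw [PowerSeries.coeff_map]; exact f.isUnit.map _⟩
  invFun f := ⟨PowerSeries.map (σ.symm : R →+* R) f.series, by
    have hσ' : F.map (σ.symm : R →+* R) = F := by
      conv_lhs => rw [← hσ]
      apply FormalGroup.ext
      ext m
      simp
    have := f.isHom.map (σ.symm : R →+* R); rwa [hσ'] at this, by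
    rw [PowerSeries.coeff_map]; exact f.isUnit.map _⟩
  left_inv f := by ext; simp
  right_inv f := by ext; simp
  map_mul' f g := FGLAut.ext (map_subst_one (τ := Unit) (σ : R →+* R) f.series g.isHom.constCoeff)

end Aut

section Morava

variable (p n : ℕ) [Fact p.Prime] [NeZero n]

/-- The Galois group `Gal(𝔽_{p^n}/𝔽_p)`. -/
abbrev Gal : Type := GaloisField p n ≃ₐ[ZMod p] GaloisField p n

lemma honda_map {S : Type*} [CommRing S] (φ : GaloisField p n →+* S) :
    (honda p n).map φ = (hondaInt p n).map (Int.castRingHom S) := by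
  apply FormalGroup.ext
  ext m
  simp [honda]

/-- The strict Morava stabilizer group `𝕊_n = Aut(H_n)`. -/
abbrev StrictMorava : Type := FGLAut (honda p n)

/-- The Galois group acts on `𝕊_n` through the coefficients. -/
def galAct : Gal p n →* MulAut (StrictMorava p n) where
  toFun σ := FGLAut.mapEquiv σ.toRingEquiv (honda_map p n _)
  map_one' := by
    ext f m
    rfl
  map_mul' σ τ := by
    ext f m
    rfl

/-- The (extended) Morava stabilizer group `𝔾_n = 𝕊_n ⋊ Gal(𝔽_{p^n}/𝔽_p)`. -/
abbrev Morava : Type := StrictMorava p n ⋊[galAct p n] Gal p n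

/-- The topology of `𝔾_n`: the product of the `X`-adic topology of `𝕊_n` and the discrete topology
of the Galois group. -/
instance : TopologicalSpace (Morava p n) :=
  TopologicalSpace.induced (fun g => (g.left, g.right))
    (@instTopologicalSpaceProd _ _ inferInstance ⊥)

/-- `𝔾_n` acts on `𝔽_{p^n}ˣ` through the Galois group. -/
instance : MulDistribMulAction (Morava p n) (GaloisField p n)ˣ :=
  MulDistribMulAction.compHom _ (SemidirectProduct.rightHom (φ := galAct p n))

lemma morava_smul (g : Morava p n) (x : (GaloisField p n)ˣ) :
    ((g • x : (GaloisField p n)ˣ) : GaloisField p n) = g.right x := rfl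

end Morava

/-! ### First continuous cohomology with discrete coefficients -/

section Cohomology

variable (G M : Type*) [Group G] [TopologicalSpace G] [CommGroup M] [MulDistribMulAction G M]

/-- The continuous crossed homomorphisms from `G` to the discrete `G`-module `M`. -/
def contCocycles₁ : Subgroup (G → M) where
  carrier := {f | IsLocallyConstant f ∧ groupCohomology.IsMulCocycle₁ f}
  mul_mem' := by
    rintro a b ⟨ha, ha'⟩ ⟨hb, hb'⟩
    refine ⟨ha.mul hb, fun g h => ?_⟩
    simp only [Pi.mul_apply, ha' g h, hb' g h, smul_mul']
    exact mul_mul_mul_comm _ _ _ _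
  one_mem' := ⟨IsLocallyConstant.const 1, fun g h => by simp⟩
  inv_mem' := by
    rintro a ⟨ha, ha'⟩
    refine ⟨ha.inv, fun g h => ?_⟩
    simp only [Pi.inv_apply, ha' g h, smul_inv', mul_inv]

/-- The principal crossed homomorphisms `g ↦ g x / x`, among the continuous ones. -/
def contCoboundaries₁ : Subgroup (contCocycles₁ G M) where
  carrier := {f | groupCohomology.IsMulCoboundary₁ f.1}
  mul_mem' := by
    rintro a b ⟨x, hx⟩ ⟨y, hy⟩
    refine ⟨x * y, fun g => ?_⟩
    simp only [Subgroup.coe_mul, Pi.mul_apply, ← hx, ← hy, smul_mul']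
    exact mul_div_mul_comm _ _ _ _
  one_mem' := ⟨1, fun g => by simp⟩
  inv_mem' := by
    rintro a ⟨x, hx⟩
    refine ⟨x⁻¹, fun g => ?_⟩
    simp only [InvMemClass.coe_inv, Pi.inv_apply, ← hx, smul_inv', inv_div, div_inv_eq_mul]
    rw [mul_comm, div_eq_mul_inv]

/-- The first continuous cohomology group `H¹(G, M)` of a topological group `G` with coefficients
in a discrete `G`-module `M` (written multiplicatively): continuous crossed homomorphisms modulo
principal ones, that is, the degree one cohomology of
`M → Homᶜ(G, M) → Homᶜ(G × G, M) → ⋯`. -/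
abbrev contH1 : Type _ := contCocycles₁ G M ⧸ contCoboundaries₁ G M

variable {G M}

/-- The cohomology class of a continuous crossed homomorphism. -/
def contH1Class (f : G → M) (hf : f ∈ contCocycles₁ G M) : contH1 G M :=
  QuotientGroup.mk ⟨f, hf⟩

end Cohomology

/-! ### Lubin-Tate deformation theory and the action of `𝔾_n` on `E_*` -/

section LubinTate

open IsLocalRing

universe u

/-- A deformation of a formal group law `H` over `k` to a local ring `R` with maximal ideal `𝔪`:
a homomorphism `ι : k → R/𝔪` and a commutative formal group law over `R` whose reduction modulo
`𝔪` is `ι_* H`. -/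
structure Deformation {k : Type*} [CommRing k] (H : FormalGroup k)
    (R : Type*) [CommRing R] [IsLocalRing R] where
  ι : k →+* ResidueField R
  law : FormalGroup R
  isComm : law.IsComm
  reduction : law.map (residue R) = H.map ι

/-- A local homomorphism `φ : R → R'` compatible with the maps from `k` to the residue fields,
together with a `⋆`-isomorphism `f : φ_* F → F'`, that is, an isomorphism of formal group laws that
reduces to the identity modulo the maximal ideal. -/
structure Deformation.IsMorphism {k : Type*} [CommRing k] {H : FormalGroup k}
    {R : Type*} [CommRing R] [IsLocalRing R] {R' : Type*} [CommRing R'] [IsLocalRing R']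
    (D : Deformation H R) (D' : Deformation H R') (φ : R →+* R') (f : PowerSeries R') : Prop where
  isLocalHom : IsLocalHom φ
  residue_comp : ∀ (x : k) (a : R), residue R a = D.ι x → residue R' (φ a) = D'.ι x
  isHom : IsHom (D.law.map φ) D'.law f
  reduction : PowerSeries.map (residue R') f = PowerSeries.X

/-- A universal deformation: `R` has residue field `k`, and for every deformation to a complete
Noetherian local ring there is exactly one morphism from the universal one. For `H = H_n` this
describes the Lubin-Tate ring `R = (E_n)_0` with its universal formal group law. -/
structure Deformation.IsUniversal {k : Type*} [CommRing k] {H : FormalGroup k}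
    {R : Type u} [CommRing R] [IsLocalRing R] (D : Deformation H R) : Prop where
  isNoetherianRing : IsNoetherianRing R
  isAdicComplete : IsAdicComplete (maximalIdeal R) R
  bijective : Function.Bijective D.ι
  existsUnique : ∀ (R' : Type u) [CommRing R'] [IsLocalRing R'] [IsNoetherianRing R']
    [IsAdicComplete (maximalIdeal R') R'] (D' : Deformation H R'),
    ∃! φf : (R →+* R') × PowerSeries R', D.IsMorphism D' φf.1 φf.2

variable {p n : ℕ} [Fact p.Prime] [NeZero n] {R : Type u} [CommRing R] [IsLocalRing R]

/-- `(φ, h)` lifts `g = (s, σ) ∈ 𝔾_n` to the deformation `F` of `H_n` over `R`: `φ : R → R` lifts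
`σ`, and `h : φ_* F → F` is an isomorphism of formal group laws that lifts `s`. -/
structure IsLift (D : Deformation (honda p n) R) (g : Morava p n)
    (φ : R →+* R) (h : PowerSeries R) : Prop where
  isLocalHom : IsLocalHom φ
  residue_comp : ∀ (x : GaloisField p n) (a : R), residue R a = D.ι x →
    residue R (φ a) = D.ι (g.right x)
  isHom : IsHom (D.law.map φ) D.law h
  reduction : PowerSeries.map (residue R) h = PowerSeries.map D.ι g.left.series

lemma isUnit_of_map_residue {D : Deformation (honda p n) R} (s : StrictMorava p n)
    {h : PowerSeries R} (hh : PowerSeries.map (residue R) h = PowerSeries.map D.ι s.series) :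
    IsUnit (PowerSeries.coeff 1 h) := by
  have h1 := congrArg (PowerSeries.coeff 1) hh
  rw [PowerSeries.coeff_map, PowerSeries.coeff_map] at h1
  apply isUnit_of_map_unit (residue R)
  rw [h1]
  exact s.isUnit.map D.ι

/-- By the universal property, each element of `𝔾_n` has exactly one lift. -/
theorem existsUnique_isLift {D : Deformation (honda p n) R} (hD : D.IsUniversal)
    (g : Morava p n) : ∃! φh : (R →+* R) × PowerSeries R, IsLift D g φh.1 φh.2 := by
  have := hD.isNoetherianRing
  have := hD.isAdicComplete
  have := D.isComm
  -- a lift `t` of the power series `s`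
  obtain ⟨t, ht0, ht⟩ : ∃ t : PowerSeries R, PowerSeries.constantCoeff t = 0 ∧
      PowerSeries.map (residue R) t = PowerSeries.map D.ι g.left.series := by
    choose l hl using residue_surjective (R := R)
    refine ⟨PowerSeries.mk fun m => if m = 0 then 0 else
      l (D.ι (PowerSeries.coeff m g.left.series)), ?_, ?_⟩
    · rw [← PowerSeries.coeff_zero_eq_constantCoeff_apply]
      simp
    · ext m
      rw [PowerSeries.coeff_map, PowerSeries.coeff_mk, PowerSeries.coeff_map]
      split_ifs with hm
      · subst hm
        rw [PowerSeries.coeff_zero_eq_constantCoeff_apply, g.left.isHom.constCoeff]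
        simp
      · exact hl _
  have htu := isUnit_of_map_residue g.left ht
  have hconj := isHom_conj D.law t ht0 htu
  have hmapt : IsUnit (PowerSeries.coeff 1 (PowerSeries.map (residue R) t)) := by
    rw [PowerSeries.coeff_map]; exact htu.map _
  -- the deformation obtained by transport along `t`
  let D' : Deformation (honda p n) R :=
    { ι := D.ι.comp (g.right.toRingEquiv : GaloisField p n →+* GaloisField p n)
      law := conj D.law t ht0 htu
      isComm := inferInstance
      reduction := by
        refine IsHom.ext_source (hconj.map (residue R)) ?_ hmapt
        rw [ht, D.reduction]
        have := g.left.isHom.map D.ι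
        rwa [honda_map, honda_map] at * }
  have hinv : ∀ {h : PowerSeries R}, PowerSeries.constantCoeff h = 0 →
      t.subst ((t.substInvOfIsUnit htu).subst h : PowerSeries R) = h := by
    intro h h0
    rw [subst_subst (τ := Unit) t (by simp) h0,
      PowerSeries.subst_substInvOfIsUnit_right t ht0 htu, X_subst_eq (τ := Unit) h0]
  have hinv' : ∀ {h : PowerSeries R}, PowerSeries.constantCoeff h = 0 →
      (t.substInvOfIsUnit htu).subst (t.subst h : PowerSeries R) = h := by
    intro h h0
    rw [subst_subst (τ := Unit) _ ht0 h0,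
      PowerSeries.subst_substInvOfIsUnit_left t ht0 htu, X_subst_eq (τ := Unit) h0]
  obtain ⟨⟨φ, f⟩, hφf, huniq⟩ := hD.existsUnique R D'
  refine ⟨(φ, t.subst f), ⟨hφf.isLocalHom, hφf.residue_comp, hconj.comp hφf.isHom, ?_⟩, ?_⟩
  · refine (map_subst_one (τ := Unit) (residue R) t hφf.isHom.constCoeff).trans ?_
    have := hφf.reduction
    rw [ht]
    change PowerSeries.subst (PowerSeries.map (residue R) f) _ = _
    rw [this]
    exact PowerSeries.X_subst _
  · rintro ⟨ψ, h⟩ hψ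
    have hm : D.IsMorphism D' ψ ((t.substInvOfIsUnit htu).subst h : PowerSeries R) := by
      refine ⟨hψ.isLocalHom, hψ.residue_comp, (isHom_inv hconj htu).comp hψ.isHom, ?_⟩
      refine (map_subst_one (τ := Unit) (residue R) _ hψ.isHom.constCoeff).trans ?_
      change PowerSeries.subst (PowerSeries.map (residue R) h) _ = _
      rw [hψ.reduction, ← ht]
      refine (map_subst_one (τ := Unit) (residue R) _ ht0).symm.trans ?_
      have := PowerSeries.subst_substInvOfIsUnit_left t ht0 htu
      exact (congrArg (PowerSeries.map (residue R)) this).trans (PowerSeries.map_X _)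
    have e := huniq (ψ, ((t.substInvOfIsUnit htu).subst h : PowerSeries R)) hm
    rw [Prod.mk.injEq] at e
    obtain ⟨rfl, e⟩ := e
    rw [← e, hinv hψ.isHom.constCoeff]

variable {D : Deformation (honda p n) R} (hD : D.IsUniversal) (g : Morava p n)

/-- The action of `g ∈ 𝔾_n` on `E_0`. -/
def actE0 : R →+* R := (existsUnique_isLift hD g).choose.1

/-- The isomorphism `φ_* F → F` that lifts `g ∈ 𝔾_n`, where `φ` is the action of `g` on `E_0`. -/
def liftSeries : PowerSeries R := (existsUnique_isLift hD g).choose.2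

lemma isLift : IsLift D g (actE0 hD g) (liftSeries hD g) :=
  (existsUnique_isLift hD g).choose_spec.1

open LaurentPolynomial

/-- The action of `g ∈ 𝔾_n` on `E_* = E_0[u, u⁻¹]`: it is the given one on `E_0`, and the polynomial
generator `u` is multiplied by `h'(0)` where `h : φ_* F → F` is the isomorphism that lifts `g`. -/
def actE : R[T;T⁻¹] →+* R[T;T⁻¹] :=
  LaurentPolynomial.eval₂ (LaurentPolynomial.C.comp (actE0 hD g))
    (Units.map (LaurentPolynomial.C : R →+* R[T;T⁻¹]).toMonoidHom
      (isUnit_of_map_residue g.left (isLift hD g).reduction).unit *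
        ⟨T 1, T (-1), by rw [← T_add, add_neg_cancel, T_zero], by rw [← T_add, neg_add_cancel, T_zero]⟩)

lemma exists_t0 : ∃ c : Rˣ, actE hD g (T 1) = LaurentPolynomial.C (c : R) * T 1 :=
  ⟨(isUnit_of_map_residue g.left (isLift hD g).reduction).unit, by simp [actE]⟩

/-- The crossed homomorphism `t₀ : 𝔾_n → E_0ˣ`, `g ↦ g_* u / u`. -/
def t0 : Rˣ := (exists_t0 hD g).choose

lemma t0_spec : actE hD g (T 1) = LaurentPolynomial.C (t0 hD g : R) * T 1 :=
  (exists_t0 hD g).choose_spec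

/-- The composite `η : 𝔾_n → E_0ˣ → 𝔽_{p^n}ˣ` of `t₀` and the reduction modulo the maximal
ideal. -/
def eta : (GaloisField p n)ˣ :=
  Units.map (RingEquiv.ofBijective D.ι hD.bijective).symm.toMonoidHom
    (Units.map (residue R).toMonoidHom (t0 hD g))

/-- The crossed homomorphism `(s, σ) ↦ s'(0)` from `𝔾_n` to `𝔽_{p^n}ˣ`. -/
def leadingCoeff (g : Morava p n) : (GaloisField p n)ˣ := g.left.leadingCoeff

end LubinTate

end MoravaPic

end

namespace MoravaPic

open MvPowerSeries (X)
open Filter Topology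

/-! ### Scalar endomorphisms `X ↦ cX` of a formal group law. -/

section Scaling

variable {R : Type*} [CommRing R]

/-! Write `q = p ^ n`. A continuous crossed homomorphism `c` on `𝔾_n = 𝕊_n ⋊ Gal` is determined by
its restrictions to the two factors. On the Galois group it is principal, by Hilbert 90. On `𝕊_n`,
which acts trivially on the units of `𝔽_q`, it is a continuous character.

Such characters are powers of `s ↦ s'(0)`. Indeed, if `s'(0) = 1` then `s ^ (p ^ j)` tends to `1`:
in characteristic `p`, each `p`-th power moves the first deviation from `X` up by at least one
degree. A locally constant character to a group of order `q - 1`, prime to `p`, therefore kills `s`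
(`character_eq_one`). So a character depends only on `s'(0)`, and it is determined by its value at
`X ↦ ωX` for a generator `ω` of the cyclic group of units (`exists_character_eq_zpow`).

That `X ↦ ωX` is an automorphism of `H_n` is a grading statement: the logarithm lives in degrees `q
^ k`, which are all `1` modulo `q - 1`, so the formal group law does too (`coeff_hondaRat_eq_zero`),
and `ω ^ (q - 1) = 1`.

Hence every `c` is cohomologous to a power of `(s, σ) ↦ s'(0)`. The order of this class is exactly
`q - 1`: a principal crossed homomorphism vanishes on `𝕊_n`, whereas `s'(0)` takes the value `ω`
there. Finally `t₀(g) = h'(0)`, where `h` lifts `s`, so its reduction `η` is `s'(0)` itself. -/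

lemma smul_X_subst {τ : Type*} (c : R) {a : MvPowerSeries τ R} (ha : a.constantCoeff = 0) :
    (c • PowerSeries.X : PowerSeries R).subst a = c • a := by
  rw [PowerSeries.subst_smul (.of_constantCoeff_zero ha), X_subst_eq ha]

lemma coeff_subst_smul_pair (c : R) (G : MvPowerSeries (Fin 2) R) (m : Fin 2 →₀ ℕ) :
    (G.subst ![c • X 0, c • X 1]).coeff m = c ^ m.degree * G.coeff m := by
  -- Both variables are scaled by the same `c`, so the substitution is a `rescale` whose weights
  -- multiply to a power of `c` with the total degree as exponent.
  have e : (![c • X 0, c • X 1] : Fin 2 → MvPowerSeries (Fin 2) R) = (fun _ => c : Fin 2 → R) • (X : Fin 2 → MvPowerSeries (Fin 2) R) := by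
    ext1 s; fin_cases s <;> rfl
  rw [e, ← MvPowerSeries.rescale_eq_subst, MvPowerSeries.coeff_rescale,
    Finsupp.prod_fintype _ _ (by simp), Fin.prod_univ_two, ← pow_add, Finsupp.degree_eq_sum,
    Fin.sum_univ_two]

/-- Multiplication by `c` is an endomorphism of `F` if and only if `c ^ d = c` on the coefficients
of degree `d`. -/
lemma isHom_smul_X_iff (F : FormalGroup R) (c : R) :
    IsHom F F (c • PowerSeries.X) ↔
      ∀ m, c * F.toPowerSeries.coeff m = c ^ m.degree * F.toPowerSeries.coeff m := by
  have h0 : (X 0 : MvPowerSeries (Fin 2) R).constantCoeff = 0 := by simp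
  have h1 : (X 1 : MvPowerSeries (Fin 2) R).constantCoeff = 0 := by simp
  have key : ((c • PowerSeries.X : PowerSeries R).subst F.toPowerSeries =
    F.toPowerSeries.subst ![(c • PowerSeries.X : PowerSeries R).subst (X 0 : MvPowerSeries (Fin 2) R),
      (c • PowerSeries.X : PowerSeries R).subst (X 1 : MvPowerSeries (Fin 2) R)]) ↔
      ∀ m, c * F.toPowerSeries.coeff m = c ^ m.degree * F.toPowerSeries.coeff m := by
    rw [smul_X_subst c F.zero_constantCoeff, smul_X_subst c h0, smul_X_subst c h1,
      MvPowerSeries.ext_iff]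
    refine forall_congr' fun m => ?_
    rw [coeff_subst_smul_pair, MvPowerSeries.coeff_smul]
  exact ⟨fun h => key.1 h.map_add, fun h => ⟨by simp, key.2 h⟩⟩

/-- If the logarithm `f` of `F` satisfies `f(cX) = c f(X)`, then multiplication by `c` is an
endomorphism of `F`. -/
lemma isHom_smul_X_of_log {F : FormalGroup R} {f : PowerSeries R}
    (hf : IsHom F FormalGroup.𝔾ₐ f) (hu : IsUnit (PowerSeries.coeff 1 f)) {c : R}
    (hc : ∀ m, c ^ m * PowerSeries.coeff m f = c * PowerSeries.coeff m f) :
    IsHom F F (c • PowerSeries.X) := by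
  have hcX : PowerSeries.constantCoeff (c • PowerSeries.X : PowerSeries R) = 0 := by simp
  -- The additive law has coefficients only in degree `1`, so every scalar satisfies the criterion.
  have hG : IsHom (FormalGroup.𝔾ₐ (R := R)) FormalGroup.𝔾ₐ (c • PowerSeries.X) := by
    rw [isHom_smul_X_iff]
    intro m
    by_cases hm : m.degree = 1
    · rw [hm, pow_one]
    · classical
      have : ∀ i : Fin 2, m ≠ Finsupp.single i 1 := by
        rintro i rfl
        exact hm (Finsupp.degree_single _ _)
      simp [FormalGroup.𝔾ₐ_toPowerSeries, MvPowerSeries.coeff_X, this]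
  -- The endomorphism `f⁻¹(c f(X))` of `F` equals `f⁻¹(f(cX)) = cX`, since `hc` says that scaling
  -- commutes with `f`.
  have h := (isHom_inv hf hu).comp (hG.comp hf)
  have e : (c • PowerSeries.X : PowerSeries R).subst f =
      (f.subst (c • PowerSeries.X : PowerSeries R) : PowerSeries R) := by
    refine (smul_X_subst (τ := Unit) c hf.constCoeff).trans ?_
    rw [← PowerSeries.rescale_eq_subst]
    ext m
    rw [PowerSeries.coeff_rescale, hc]
    exact MvPowerSeries.coeff_smul ..
  rw [e, subst_subst (τ := Unit) _ hf.constCoeff hcX,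
    PowerSeries.subst_substInvOfIsUnit_left f hf.constCoeff hu, X_subst_eq (τ := Unit) hcX] at h
  exact h

end Scaling

/-! ### The grading of the Honda law and its scalar automorphisms. -/

section HondaGrading

variable (p n : ℕ) [Fact p.Prime] [NeZero n]

/-- The nonzero coefficients of `hondaRat` lie in degrees congruent to `1` modulo `p ^ n - 1`. -/
lemma coeff_hondaRat_eq_zero {m : Fin 2 →₀ ℕ} (hm : ¬ ∃ k, m.degree = (p ^ n - 1) * k + 1) :
    (hondaRat p n).toPowerSeries.coeff m = 0 := by
  have hq := one_lt_pow' (p := p) (n := n)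
  rcases Nat.eq_zero_or_pos m.degree with h0 | hpos
  · rw [Finsupp.degree_eq_zero_iff] at h0
    rw [h0, MvPowerSeries.coeff_zero_eq_constantCoeff_apply, (hondaRat p n).zero_constantCoeff]
  -- A primitive `(p ^ n - 1)`-th root of unity detects degrees modulo `p ^ n - 1`. It is taken in
  -- `ℂ`; since `φ` is injective, vanishing there gives vanishing over `ℚ`.
  let φ : ℚ →+* ℂ := algebraMap ℚ ℂ
  set ζ : ℂ := Complex.exp (2 * Real.pi * Complex.I / (p ^ n - 1 : ℕ)) with hζdef
  have hζ : IsPrimitiveRoot ζ (p ^ n - 1) := Complex.isPrimitiveRoot_exp _ (by lia)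
  have hζ0 : ζ ≠ 0 := hζ.ne_zero (by lia)
  have hlog : IsHom ((hondaRat p n).map φ) FormalGroup.𝔾ₐ (PowerSeries.map φ (hondaLog p n)) := by
    have h := (isHom_conj FormalGroup.𝔾ₐ (hondaLog p n) (constCoeff_hondaLog p n)
      (isUnit_coeff_one_hondaLog p n)).map φ
    have e : (FormalGroup.𝔾ₐ (R := ℚ)).map φ = FormalGroup.𝔾ₐ := by
      apply FormalGroup.ext
      simp
    rwa [e] at h
  have hu : IsUnit (PowerSeries.coeff 1 (PowerSeries.map φ (hondaLog p n))) := by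
    rw [PowerSeries.coeff_map]
    exact (isUnit_coeff_one_hondaLog p n).map φ
  -- The logarithm is supported on the powers of `p ^ n`, and `ζ ^ (p ^ n) = ζ`.
  have hX := isHom_smul_X_of_log hlog hu (c := ζ) fun j => by
    by_cases hj : ∃ k, j = (p ^ n) ^ k
    · obtain ⟨k, rfl⟩ := hj
      have hζq : ζ ^ p ^ n = ζ := by
        conv_lhs => rw [show p ^ n = (p ^ n - 1) + 1 by lia, pow_succ, hζ.pow_eq_one, one_mul]
      have : ζ ^ (p ^ n) ^ k = ζ := by
        induction k with
        | zero => simp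
        | succ k ih => rw [pow_succ, pow_mul, ih, hζq]
      rw [this]
    · push Not at hj
      simp [PowerSeries.coeff_map, coeff_hondaLog_of_ne hj]
  have hc := (isHom_smul_X_iff _ ζ).1 hX m
  rw [FormalGroup.map_toPowerSeries, MvPowerSeries.coeff_map] at hc
  by_contra hne
  have hne' : φ ((hondaRat p n).toPowerSeries.coeff m) ≠ 0 := (map_ne_zero φ).2 hne
  -- A nonzero coefficient forces `ζ = ζ ^ m.degree`; with `m.degree = d + 1` this says `ζ ^ d = 1`,
  -- so `p ^ n - 1` divides `d`.
  have h1 := mul_right_cancel₀ hne' hc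
  obtain ⟨d, hd⟩ := Nat.exists_eq_add_of_lt hpos
  rw [zero_add] at hd
  rw [hd, pow_succ] at h1
  have h2 : ζ ^ d = 1 := by
    apply mul_right_cancel₀ hζ0
    rw [one_mul, ← h1]
  obtain ⟨k, hk⟩ := (hζ.pow_eq_one_iff_dvd d).1 h2
  exact hm ⟨k, by rw [hd, hk]⟩

variable {p n}

/-- Since `ω ^ (p ^ n - 1) = 1`, the criterion holds in degrees `1` modulo `p ^ n - 1`. In other
degrees the rational coefficient vanishes, hence also the integral one and its reduction. -/
lemma isHom_honda_smul_X (ω : (GaloisField p n)ˣ) :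
    IsHom (honda p n) (honda p n) ((ω : GaloisField p n) • PowerSeries.X) := by
  rw [isHom_smul_X_iff]
  intro m
  by_cases hm : ∃ k, m.degree = (p ^ n - 1) * k + 1
  · obtain ⟨k, hk⟩ := hm
    have : Fintype (GaloisField p n) := Fintype.ofFinite _
    have h1 : (ω : GaloisField p n) ^ (p ^ n - 1) = 1 := by
      rw [← GaloisField.card p n (NeZero.ne n), Nat.card_eq_fintype_card]
      exact FiniteField.pow_card_sub_one_eq_one _ ω.ne_zero
    rw [hk, pow_succ, pow_mul, h1, one_pow, one_mul]
  · have h := coeff_hondaRat_eq_zero p n hm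
    rw [← hondaInt_map, FormalGroup.map_toPowerSeries, MvPowerSeries.coeff_map, eq_intCast,
      Int.cast_eq_zero] at h
    simp [honda, h]

/-- The automorphism `X ↦ ω X` of the Honda formal group law. -/
noncomputable def scalarAut (ω : (GaloisField p n)ˣ) : StrictMorava p n where
  series := (ω : GaloisField p n) • PowerSeries.X
  isHom := isHom_honda_smul_X ω
  isUnit := by simp

end HondaGrading

/-! ### Iterates of automorphisms with leading coefficient `1`. -/

section Filtration

variable {R : Type*} [CommRing R] {F : FormalGroup R}

/-- Composition of power series congruent to `X` modulo `X ^ (m + 2)` is additive modulo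
`X ^ (m + 3)`. -/
lemma X_pow_dvd_subst_sub {m : ℕ} {s t : PowerSeries R}
    (hs : PowerSeries.X ^ (m + 2) ∣ s - PowerSeries.X)
    (ht : PowerSeries.X ^ (m + 2) ∣ t - PowerSeries.X) :
    PowerSeries.X ^ (m + 3) ∣ s.subst t - (s + t - PowerSeries.X) := by
  obtain ⟨g, hg⟩ := hs
  obtain ⟨h, hh⟩ := ht
  obtain rfl : s = PowerSeries.X + PowerSeries.X ^ (m + 2) * g := by rw [← hg]; ring
  obtain rfl : t = PowerSeries.X + PowerSeries.X ^ (m + 2) * h := by rw [← hh]; ring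
  clear hg hh
  set t : PowerSeries R := PowerSeries.X + PowerSeries.X ^ (m + 2) * h with ht
  have ht0 : PowerSeries.constantCoeff t = 0 := by simp [ht]
  have hst : PowerSeries.HasSubst t := .of_constantCoeff_zero' ht0
  obtain ⟨g', hg'⟩ : PowerSeries.X ∣ g - PowerSeries.C (PowerSeries.constantCoeff g) := by
    rw [PowerSeries.X_dvd_iff]; simp
  have hXt : t = PowerSeries.X * (1 + PowerSeries.X * (PowerSeries.X ^ m * h)) := by
    rw [ht]; ring
  -- Substituting `t`, which has no constant term, does not change the constant term of `g`.
  have hgt : PowerSeries.X ∣ g.subst t - g := by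
    have e : g = PowerSeries.C (PowerSeries.constantCoeff g) + PowerSeries.X * g' := by
      rw [← hg']; ring
    have e2 : g.subst t = PowerSeries.C (PowerSeries.constantCoeff g) + t * g'.subst t := by
      conv_lhs => rw [e]
      rw [PowerSeries.subst_add hst, PowerSeries.subst_mul hst, PowerSeries.subst_X hst,
        PowerSeries.subst_C]
      rfl
    have e3 : g.subst t - g = t * g'.subst t - PowerSeries.X * g' := by
      rw [e2, ← hg']; ring
    rw [e3]
    refine dvd_sub (Dvd.dvd.mul_right ?_ _) (dvd_mul_right _ _)
    rw [hXt]
    exact dvd_mul_right _ _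
  -- As `t` is `X` times a series `≡ 1` modulo `X`, its `(m + 2)`-th power is `X ^ (m + 2)` times
  -- another such series.
  have hpow : PowerSeries.X ^ (m + 3) ∣ t ^ (m + 2) - PowerSeries.X ^ (m + 2) := by
    have h1 := sub_dvd_pow_sub_pow
      (1 + PowerSeries.X * (PowerSeries.X ^ m * h) : PowerSeries R) 1 (m + 2)
    rw [add_sub_cancel_left, one_pow] at h1
    obtain ⟨w, hw⟩ := (dvd_mul_right _ _).trans h1
    refine ⟨w, ?_⟩
    rw [hXt, mul_pow]
    linear_combination PowerSeries.X ^ (m + 2) * hw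
  have e : (PowerSeries.X + PowerSeries.X ^ (m + 2) * g : PowerSeries R).subst t =
      t + t ^ (m + 2) * g.subst t := by
    rw [PowerSeries.subst_add hst, PowerSeries.subst_mul hst, PowerSeries.subst_pow hst,
      PowerSeries.subst_X hst]
  rw [e]
  obtain ⟨a, ha⟩ := hgt
  obtain ⟨b, hb⟩ := hpow
  -- The difference is `t ^ (m + 2) g(t) - X ^ (m + 2) g = (t ^ (m + 2) - X ^ (m + 2)) g(t) + X ^ (m
  -- + 2) (g(t) - g)`.
  refine ⟨b * g.subst t + a, ?_⟩
  linear_combination (g.subst t : PowerSeries R) * hb + PowerSeries.X ^ (m + 2) * ha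

/-- Deviations from `X` add under composition to this precision, so `k` factors multiply the
deviation by `k`. -/
lemma X_pow_dvd_pow_sub {m : ℕ} {s : FGLAut F}
    (hs : PowerSeries.X ^ (m + 2) ∣ s.series - PowerSeries.X) (k : ℕ) :
    PowerSeries.X ^ (m + 3) ∣
      (s ^ k).series - (PowerSeries.X + (k : PowerSeries R) * (s.series - PowerSeries.X)) := by
  induction k with
  | zero => simp [FGLAut.one_series]
  | succ k ih =>
    have hk : PowerSeries.X ^ (m + 2) ∣ (s ^ k).series - PowerSeries.X := by
      have := dvd_add ((pow_dvd_pow _ (by lia)).trans ih) (hs.mul_left (k : PowerSeries R))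
      convert this using 1
      ring
    rw [pow_succ s, FGLAut.mul_series]
    convert dvd_add (X_pow_dvd_subst_sub hk hs) ih using 1
    push_cast
    ring

/-- The leading deviation is multiplied by `p = 0`, so the `p`-th power is one step deeper in the
filtration. -/
lemma X_pow_dvd_pow_char_sub (p : ℕ) [CharP R p] {m : ℕ} {s : FGLAut F}
    (hs : PowerSeries.X ^ (m + 2) ∣ s.series - PowerSeries.X) :
    PowerSeries.X ^ (m + 3) ∣ (s ^ p).series - PowerSeries.X := by
  have hp : (p : PowerSeries R) = 0 := by
    rw [← map_natCast (PowerSeries.C (R := R)), CharP.cast_eq_zero, map_zero]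
  simpa [hp] using X_pow_dvd_pow_sub hs p

lemma X_pow_dvd_pow_char_pow_sub (p : ℕ) [CharP R p] {s : FGLAut F}
    (hs : s.leadingCoeff = 1) (j : ℕ) :
    PowerSeries.X ^ (j + 2) ∣ (s ^ p ^ j).series - PowerSeries.X := by
  induction j with
  | zero =>
    rw [pow_zero, pow_one, PowerSeries.X_pow_dvd_iff]
    intro i hi
    interval_cases i
    · simp [s.isHom.constCoeff]
    · have : PowerSeries.coeff 1 s.series = 1 := congrArg Units.val hs
      simp [this]
  | succ j ih =>
    rw [pow_succ p, pow_mul s]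
    exact X_pow_dvd_pow_char_sub p ih

/-- An automorphism with leading coefficient `1` is topologically `p`-nilpotent. -/
lemma tendsto_pow_char_pow (p : ℕ) [CharP R p] {s : FGLAut F} (hs : s.leadingCoeff = 1) :
    Tendsto (fun j => s ^ p ^ j) atTop (𝓝 1) := by
  let _ : TopologicalSpace R := ⊥
  rw [nhds_induced, tendsto_comap_iff, tendsto_pi_nhds]
  intro i
  -- Convergence is coefficientwise in the discrete topology: the `i`-th coefficient agrees with
  -- that of `X` as soon as `i < j + 2`.
  refine tendsto_const_nhds.congr' ?_
  filter_upwards [eventually_ge_atTop i] with j hj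
  have := PowerSeries.X_pow_dvd_iff.1 (X_pow_dvd_pow_char_pow_sub p hs j) i (by lia)
  rw [map_sub, sub_eq_zero] at this
  exact this.symm

/-- The leading coefficient as a homomorphism. -/
noncomputable def leadingCoeffHom (F : FormalGroup R) : FGLAut F →* Rˣ where
  toFun := FGLAut.leadingCoeff
  map_one' := by
    ext
    simp [FGLAut.leadingCoeff, FGLAut.one_series]
  map_mul' s t := by
    ext
    exact coeff_one_subst t.isHom.constCoeff

/-- The leading coefficient is one of the discrete coordinates that induce the topology. -/
lemma isLocallyConstant_leadingCoeff : IsLocallyConstant (FGLAut.leadingCoeff (F := F)) := by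
  let _ : TopologicalSpace R := ⊥
  have : DiscreteTopology R := ⟨rfl⟩
  refine IsLocallyConstant.desc _ Units.val ?_ Units.val_injective
  rw [IsLocallyConstant.iff_continuous]
  exact (continuous_apply (A := fun _ => R) 1).comp (continuous_induced_dom
    (f := fun (f : FGLAut F) m => PowerSeries.coeff m f.series))

end Filtration

/-! ### Continuous crossed homomorphisms on the Morava stabilizer group. -/

section Cocycles

variable {p n : ℕ} [Fact p.Prime] [NeZero n]

lemma leadingCoeff_scalarAut (ω : (GaloisField p n)ˣ) : (scalarAut ω).leadingCoeff = ω := by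
  ext
  simp [FGLAut.leadingCoeff, scalarAut]

lemma continuous_inl : Continuous (SemidirectProduct.inl : StrictMorava p n → Morava p n) := by
  let _ : TopologicalSpace (Gal p n) := ⊥
  exact continuous_induced_rng.2 (continuous_id.prodMk continuous_const)

lemma isLocallyConstant_leadingCoeff_morava :
    IsLocallyConstant (leadingCoeff : Morava p n → (GaloisField p n)ˣ) := by
  let _ : TopologicalSpace (Gal p n) := ⊥
  exact isLocallyConstant_leadingCoeff.comp_continuous
    (f := fun g : Morava p n => g.left) (continuous_fst.comp
      (continuous_induced_dom (f := fun g : Morava p n => (g.left, g.right))))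

/-- The left component of `(s, σ)(t, τ)` is `s · σ(t)`. Leading coefficients multiply under
composition, and that of `σ(t)` is `σ(t'(0))`. -/
lemma leadingCoeff_mem_contCocycles₁ :
    (leadingCoeff : Morava p n → (GaloisField p n)ˣ) ∈
      contCocycles₁ (Morava p n) (GaloisField p n)ˣ := by
  refine ⟨isLocallyConstant_leadingCoeff_morava, fun g h => ?_⟩
  change leadingCoeffHom _ (g.left * galAct p n g.right h.left) = _
  rw [map_mul, mul_comm]
  congr 1
  ext
  rw [morava_smul]
  exact PowerSeries.coeff_map _ _ _

/-- Consequently crossed homomorphisms restrict to characters of `𝕊_n`, and principal ones restrict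
to `1`. -/
lemma inl_smul (s : StrictMorava p n) (x : (GaloisField p n)ˣ) :
    (SemidirectProduct.inl s : Morava p n) • x = x := by
  ext
  rw [morava_smul]
  rfl

lemma card_units_galoisField : Nat.card (GaloisField p n)ˣ = p ^ n - 1 := by
  rw [Nat.card_units, GaloisField.card p n (NeZero.ne n)]

/-- A continuous character of `𝕊_n` with values in `𝔽_{p^n}ˣ` is trivial on automorphisms with
leading coefficient `1`, because these form a pro-`p` group. -/
lemma character_eq_one (χ : StrictMorava p n →* (GaloisField p n)ˣ) (hχ : IsLocallyConstant χ)
    {s : StrictMorava p n} (hs : s.leadingCoeff = 1) : χ s = 1 := by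
  -- Near `1` the character equals `χ 1 = 1`, so `χ s ^ (p ^ j) = 1` for some `j`; its order is also
  -- prime to `p`.
  have h1 := tendsto_pow_char_pow p hs (hχ.eventually_eq 1)
  obtain ⟨j, hj⟩ := (Filter.eventually_map.1 h1).exists
  rw [map_pow, map_one] at hj
  have h2 : χ s ^ (p ^ n - 1) = 1 := by
    rw [← card_units_galoisField (p := p) (n := n)]
    exact pow_card_eq_one'
  have hq := one_lt_pow' (p := p) (n := n)
  have hco : Nat.Coprime (p ^ j) (p ^ n - 1) := by
    refine Nat.Coprime.pow_left _ (((Fact.out : p.Prime).coprime_iff_not_dvd).2 fun hd => ?_)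
    have h3 : p ∣ p ^ n := dvd_pow_self p (NeZero.ne n)
    have h4 := (Nat.dvd_sub_iff_right hq.le h3).1 hd
    exact (Fact.out : p.Prime).one_lt.ne' (Nat.dvd_one.1 h4)
  rw [← orderOf_eq_one_iff, ← Nat.dvd_one, ← hco.gcd_eq_one]
  exact Nat.dvd_gcd (orderOf_dvd_of_pow_eq_one hj) (orderOf_dvd_of_pow_eq_one h2)

/-- The continuous characters of `𝕊_n` with values in `𝔽_{p^n}ˣ` are the powers of the leading
coefficient. -/
lemma exists_character_eq_zpow (χ : StrictMorava p n →* (GaloisField p n)ˣ)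
    (hχ : IsLocallyConstant χ) : ∃ k : ℤ, ∀ s, χ s = s.leadingCoeff ^ k := by
  obtain ⟨ω, hω⟩ := IsCyclic.exists_generator (α := (GaloisField p n)ˣ)
  obtain ⟨k, hk⟩ := hω (χ (scalarAut ω))
  refine ⟨k, fun s => ?_⟩
  obtain ⟨j, hj⟩ := hω s.leadingCoeff
  beta_reduce at hj hk
  -- Dividing `s` by the scalar automorphism with the same leading coefficient leaves an element
  -- that `χ` kills.
  have h1 : (s * (scalarAut ω ^ j)⁻¹).leadingCoeff = 1 := by
    change leadingCoeffHom _ _ = 1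
    rw [map_mul, map_inv, map_zpow]
    change s.leadingCoeff * ((scalarAut ω).leadingCoeff ^ j)⁻¹ = 1
    rw [leadingCoeff_scalarAut, hj, mul_inv_cancel]
  have h2 := character_eq_one χ hχ h1
  rw [map_mul, map_inv, map_zpow, mul_inv_eq_one] at h2
  rw [h2, ← hk, ← hj, ← zpow_mul, ← zpow_mul, mul_comm]

/-- Every continuous crossed homomorphism is cohomologous to a power of the leading coefficient. -/
lemma zpowers_leadingCoeff_eq_top :
    Subgroup.zpowers (contH1Class (leadingCoeff : Morava p n → (GaloisField p n)ˣ)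
      leadingCoeff_mem_contCocycles₁) = ⊤ := by
  rw [eq_top_iff]
  rintro x -
  obtain ⟨⟨c, hc, hcoc⟩, rfl⟩ := QuotientGroup.mk_surjective x
  -- Hilbert 90 for `𝔽_{p^n}` over `𝔽_p`.
  obtain ⟨b, hb⟩ := groupCohomology.isMulCoboundary₁_of_isMulCocycle₁_of_aut_to_units
    (fun σ : Gal p n => c (SemidirectProduct.inr σ)) (fun σ τ => by
      beta_reduce; rw [map_mul, hcoc]; rfl)
  let χ : StrictMorava p n →* (GaloisField p n)ˣ := MonoidHom.mk'
    (fun s => c (SemidirectProduct.inl s)) fun s t => by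
      rw [map_mul, hcoc, inl_smul, mul_comm]
  obtain ⟨k, hk⟩ := exists_character_eq_zpow χ (hc.comp_continuous continuous_inl)
  refine ⟨k, ?_⟩
  -- The same `b` works on all of `𝔾_n`, because the action factors through the Galois group.
  refine QuotientGroup.eq.2 ⟨b, fun g => ?_⟩
  have hg : c g = (g.right • b / b) * g.left.leadingCoeff ^ k := by
    conv_lhs => rw [← SemidirectProduct.inl_left_mul_inr_right g]
    rw [hcoc, inl_smul, hb, ← hk]
    rfl
  change g.right • b / b = (leadingCoeff g ^ k)⁻¹ * c g
  rw [hg, leadingCoeff, mul_comm, mul_inv_cancel_right]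

lemma contH1Class_leadingCoeff_pow_eq_one_iff (k : ℕ) :
    contH1Class (leadingCoeff : Morava p n → (GaloisField p n)ˣ)
      leadingCoeff_mem_contCocycles₁ ^ k = 1 ↔
      ∃ b : (GaloisField p n)ˣ, ∀ g : Morava p n, g • b / b = leadingCoeff g ^ k := by
  let c : contCocycles₁ (Morava p n) (GaloisField p n)ˣ :=
    ⟨leadingCoeff, leadingCoeff_mem_contCocycles₁⟩
  exact QuotientGroup.eq_one_iff (N := contCoboundaries₁ (Morava p n) (GaloisField p n)ˣ) (c ^ k)

/-- The exponent of the unit group bounds the order from above. For the lower bound, a principal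
power is `1` on `𝕊_n`, and evaluating at `X ↦ ωX` with `ω` a generator gives `ω ^ k = 1`. -/
lemma orderOf_leadingCoeff :
    orderOf (contH1Class (leadingCoeff : Morava p n → (GaloisField p n)ˣ)
      leadingCoeff_mem_contCocycles₁) = p ^ n - 1 := by
  rw [← card_units_galoisField (p := p) (n := n)]
  apply Nat.dvd_antisymm
  · apply orderOf_dvd_of_pow_eq_one
    refine (contH1Class_leadingCoeff_pow_eq_one_iff _).2 ⟨1, fun g => ?_⟩
    rw [pow_card_eq_one', smul_one, div_one]
  · obtain ⟨b, hb⟩ := (contH1Class_leadingCoeff_pow_eq_one_iff _).1 (pow_orderOf_eq_one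
      (contH1Class (leadingCoeff : Morava p n → (GaloisField p n)ˣ)
        leadingCoeff_mem_contCocycles₁))
    obtain ⟨ω, hω⟩ := IsCyclic.exists_generator (α := (GaloisField p n)ˣ)
    rw [← orderOf_eq_card_of_forall_mem_zpowers hω]
    apply orderOf_dvd_of_pow_eq_one
    have h := hb (SemidirectProduct.inl (scalarAut ω))
    rw [inl_smul, div_self'] at h
    change 1 = (scalarAut ω).leadingCoeff ^ _ at h
    rw [leadingCoeff_scalarAut] at h
    exact h.symm

lemma nonempty_contH1_mulEquiv :
    Nonempty (contH1 (Morava p n) (GaloisField p n)ˣ ≃* Multiplicative (ZMod (p ^ n - 1))) := by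
  have hz := zpowers_leadingCoeff_eq_top (p := p) (n := n)
  have hcyc : IsCyclic (contH1 (Morava p n) (GaloisField p n)ˣ) :=
    ⟨_, fun x => hz.symm ▸ Subgroup.mem_top x⟩
  refine ⟨mulEquivOfCyclicCardEq ?_⟩
  rw [← orderOf_eq_card_of_zpowers_eq_top hz, orderOf_leadingCoeff]
  exact (Nat.card_zmod _).symm

end Cocycles

/-! ### The reduction of `t₀`. -/

section Eta

universe u

open IsLocalRing

variable {p n : ℕ} [Fact p.Prime] [NeZero n] {R : Type u} [CommRing R] [IsLocalRing R]
  {D : Deformation (honda p n) R}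

/-- `t0` is only chosen through its defining equation; as `u` is invertible in `E_*`, that equation
determines it. -/
lemma t0_eq_coeff_one (hD : D.IsUniversal) (g : Morava p n) :
    (t0 hD g : R) = PowerSeries.coeff 1 (liftSeries hD g) := by
  have h := t0_spec hD g
  have e : actE hD g (LaurentPolynomial.T 1) =
      LaurentPolynomial.C (PowerSeries.coeff 1 (liftSeries hD g)) * LaurentPolynomial.T 1 := by
    simp [actE]
  rw [e] at h
  -- Multiplying by `u⁻¹` leaves constants, which are compared in degree `0`.
  have h' := congrArg (· * LaurentPolynomial.T (-1)) h
  simp only [LaurentPolynomial.mul_T_assoc] at h'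
  norm_num at h'
  simpa using (congrArg (fun q : LaurentPolynomial R => q.coeff 0) h').symm

/-- The lift `h` reduces to the image of `s` under `D.ι`; comparing linear coefficients and
inverting `D.ι` turns `h'(0)` into `s'(0)`. -/
lemma eta_eq_leadingCoeff (hD : D.IsUniversal) : eta hD = leadingCoeff := by
  funext g
  ext
  change (RingEquiv.ofBijective D.ι hD.bijective).symm (residue R (t0 hD g)) =
    PowerSeries.coeff 1 g.left.series
  rw [RingEquiv.symm_apply_eq, t0_eq_coeff_one]
  have h := congrArg (PowerSeries.coeff 1) (isLift hD g).reduction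
  rw [PowerSeries.coeff_map, PowerSeries.coeff_map] at h
  exact h

end Eta

end MoravaPic

theorem mainTheorem12 (p n : ℕ) [Fact p.Prime] [NeZero n]
    (hpn : n ^ 2 ≤ 2 * p - 2) (hdvd : ¬ (p - 1) ∣ n) :
    -- `H¹(𝔾_n, 𝔽_{p^n}ˣ) ≅ ℤ/(p^n - 1)`
    Nonempty (MoravaPic.contH1 (MoravaPic.Morava p n) (GaloisField p n)ˣ ≃*
      Multiplicative (ZMod (p ^ n - 1))) ∧
    -- the class of `(s, σ) ↦ s'(0)` is a generator
    (∃ hη : (MoravaPic.leadingCoeff : MoravaPic.Morava p n → (GaloisField p n)ˣ) ∈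
        MoravaPic.contCocycles₁ (MoravaPic.Morava p n) (GaloisField p n)ˣ,
      Subgroup.zpowers (MoravaPic.contH1Class _ hη) = ⊤) ∧
    -- for every model of the Lubin-Tate ring `E_0`, the reduction `η` of `t₀` is this crossed
    -- homomorphism, so that its class is a generator
    ∀ (R : Type*) [CommRing R] [IsLocalRing R] (D : MoravaPic.Deformation (MoravaPic.honda p n) R)
      (hD : D.IsUniversal),
      MoravaPic.eta hD = MoravaPic.leadingCoeff ∧
      ∃ hη : MoravaPic.eta hD ∈
          MoravaPic.contCocycles₁ (MoravaPic.Morava p n) (GaloisField p n)ˣ,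
        Subgroup.zpowers (MoravaPic.contH1Class _ hη) = ⊤ := by
  refine ⟨MoravaPic.nonempty_contH1_mulEquiv,
    ⟨MoravaPic.leadingCoeff_mem_contCocycles₁, MoravaPic.zpowers_leadingCoeff_eq_top⟩, ?_⟩
  intro R _ _ D hD
  rw [MoravaPic.eta_eq_leadingCoeff hD]
  exact ⟨rfl, MoravaPic.leadingCoeff_mem_contCocycles₁, MoravaPic.zpowers_leadingCoeff_eq_top⟩
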